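/- A Young function is a convex, left-continuous function $A:[0,\infty)\to[0,\infty]$ with $A(0)=0$ that is identically equal neither to $0$ nor to $\infty$ on $(0,\infty)$. For a measurable function $u:\mathbb R^n\to\mathbb R$ the Luxemburg norm is $$\|u\|_{L^A(\mathbb R^n)}=\inf\Big\{\lambda>0:\ \int_{\mathbb R^n}A\Big(\frac{|u(x)|}{\lambda}\Big)\,dx\le 1\Big\},$$ and the Orlicz space $L^A(\mathbb R^n)$ is the set of those $u$ for which it is finite. Let $n\ge 1$ be an integer and $0<s<n$. For a Young function $A$ such that $\int_0^{\varepsilon}\big(\frac{t}{A(t)}\big)^{\frac{s}{n-s}}\,dt<\infty$ for some $\varepsilon>0$, define $$H(t)=\bigg(\int_0^t\Big(\frac{\tau}{A(\tau)}\Big)^{\frac{s}{n-s}}\,d\tau\bigg)^{\frac{n-s}{n}},\qquad A_{\frac ns}(t)=A\big(H^{-1}(t)\big)\qquad\text{for } t\ge 0,$$ where $H^{-1}(t)=\inf\{\tau\ge 0: H(\tau)\ge t\}$ is the generalized left-continuous inverse of $H$, with $\inf\emptyset=\infty$ and $A(\infty)=\infty$. **Theorem.** Let $n\ge1$ and $0<s<n$.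 There exists a constant $c=c(n,s)>0$, depending only on $n$ and $s$, such that for every Young function $A$ as above the function $A_{\frac ns}$ is a Young function, and for all $u\in L^A(\mathbb R^n)$ and $v\in L^{\frac n{n-s}}(\mathbb R^n)$ the integral defining the convolution $u*v(x)=\int_{\mathbb R^n}u(y)v(x-y)\,dy$ converges absolutely for a.e. $x\in\mathbb R^n$, $u*v\in L^{A_{n/s}}(\mathbb R^n)$, and $$\|u*v\|_{L^{A_{n/s}}(\mathbb R^n)}\le c\,\|v\|_{L^{\frac n{n-s}}(\mathbb R^n)}\,\|u\|_{L^A(\mathbb R^n)}.$$ Moreover, with the same constant $c$, $$\int_{\mathbb R^n}A_{\frac ns}\Bigg(\frac{|u*v|}{c\,\|v\|_{L^{\frac n{n-s}}(\mathbb R^n)}\big(\int_{\mathbb R^n}A(|u|)\,dy\big)^{s/n}}\Bigg)\,dx\le\int_{\mathbb R^n}A(|u|)\,dx,$$ where the quotient on the left is read as $0$ if $u=0$ a.e., or $v=0$ a.e., or $\int_{\mathbb R^n}A(|u|)\,dy=\infty$. -/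

import Mathlib

open MeasureTheory
open scoped ENNReal NNReal

/-- A Young function: a map `[0, ∞) → [0, ∞]` that is convex, left-continuous, vanishes at `0`, and
is identically equal neither to `0` nor to `∞` on `(0, ∞)`. -/
structure IsYoungFunction (A : ℝ≥0 → ℝ≥0∞) : Prop where
  convex : ConvexOn ℝ≥0 Set.univ A
  left_cont : ∀ t : ℝ≥0, ContinuousWithinAt A (Set.Iio t) t
  map_zero : A 0 = 0
  ne_zero : ∃ t : ℝ≥0, 0 < t ∧ A t ≠ 0
  ne_top : ∃ t : ℝ≥0, 0 < t ∧ A t ≠ ∞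

/-- The extension of `A : [0, ∞) → [0, ∞]` to `[0, ∞]` by the convention `A(∞) = ∞`. -/
noncomputable def extTop (A : ℝ≥0 → ℝ≥0∞) (t : ℝ≥0∞) : ℝ≥0∞ :=
  if t = ∞ then ∞ else A t.toNNReal

/-- The modular `∫ A(|u|) dx`, with values in `[0, ∞]`. -/
noncomputable def orliczModular {X : Type*} [MeasureSpace X] (A : ℝ≥0 → ℝ≥0∞) (u : X → ℝ) :
    ℝ≥0∞ :=
  ∫⁻ x, A ‖u x‖₊

/-- The Luxemburg norm `inf {l > 0 : ∫ A(|u| / l) dx ≤ 1}`, equal to `∞` if there is no such `l`. -/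
noncomputable def luxemburgNorm {X : Type*} [MeasureSpace X] (A : ℝ≥0 → ℝ≥0∞) (u : X → ℝ) :
    ℝ≥0∞ :=
  ⨅ (l : ℝ≥0) (_ : 0 < l ∧ ∫⁻ x, A (‖u x‖₊ / l) ≤ 1), (l : ℝ≥0∞)

/-- Membership in the Orlicz space `L^A`. -/
def MemOrlicz {X : Type*} [MeasureSpace X] (A : ℝ≥0 → ℝ≥0∞) (u : X → ℝ) : Prop :=
  AEStronglyMeasurable u volume ∧ luxemburgNorm A u < ∞

/-- The integral `∫_0^t (τ / A(τ))^{s / (n - s)} dτ`, with values in `[0, ∞]`; here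
`τ / 0 = ∞` and `τ / ∞ = 0` for `0 < τ < ∞`. -/
noncomputable def youngIntegral (n : ℕ) (s : ℝ) (A : ℝ≥0 → ℝ≥0∞) (t : ℝ≥0) : ℝ≥0∞ :=
  ∫⁻ τ in Set.Ioo (0 : ℝ) t, (ENNReal.ofReal τ / A τ.toNNReal) ^ (s / ((n : ℝ) - s))

/-- The function `H(t) = (∫_0^t (τ / A(τ))^{s / (n - s)} dτ)^{(n - s) / n}`. -/
noncomputable def youngH (n : ℕ) (s : ℝ) (A : ℝ≥0 → ℝ≥0∞) (t : ℝ≥0) : ℝ≥0∞ :=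
  youngIntegral n s A t ^ (((n : ℝ) - s) / (n : ℝ))

/-- The generalized left-continuous inverse `H⁻¹(t) = inf {τ ≥ 0 : H(τ) ≥ t}` of `H`, equal to `∞`
if there is no such `τ`. -/
noncomputable def youngHInv (n : ℕ) (s : ℝ) (A : ℝ≥0 → ℝ≥0∞) (t : ℝ≥0) : ℝ≥0∞ :=
  ⨅ (τ : ℝ≥0) (_ : (t : ℝ≥0∞) ≤ youngH n s A τ), (τ : ℝ≥0∞)

/-- The function `A_{n/s}(t) = A(H⁻¹(t))`, equal to `∞` where `H⁻¹(t) = ∞`. -/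
noncomputable def youngTarget (n : ℕ) (s : ℝ) (A : ℝ≥0 → ℝ≥0∞) (t : ℝ≥0) : ℝ≥0∞ :=
  extTop A (youngHInv n s A t)

/-- The convolution `(u * v)(x) = ∫ u(y) v(x - y) dy` of real-valued functions on `ℝⁿ`. -/
noncomputable def realConv {n : ℕ} (u v : EuclideanSpace ℝ (Fin n) → ℝ) :
    EuclideanSpace ℝ (Fin n) → ℝ :=
  MeasureTheory.convolution u v (ContinuousLinearMap.mul ℝ ℝ) volume

/-! Write `p = n/(n-s)`, `M = ∫ A(|u|)`, `N = ∫ |v|^p`. Since `t / A t` decreases, `t · A(t)^(-s/n)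
≤ H(t)` (`mul_rpow_le_youngH`). Splitting the values of `|u|` at a level `τ` gives `|u| ≤
A(|u|)^(s/n) H(τ) + (τ / A τ) A(|u|)` (`coe_le_add`). Integrate this against `|v(x - ·)|` and apply
Hölder to both terms. Let `w(x)` be the average of `A(|u|)` with weight `|v(x - ·)|^p / N`. If `A τ
> w(x)`, both terms are at most `N^(1/p) M^(s/n) H(τ)`, so `|u*v|(x) ≤ 2 N^(1/p) M^(s/n) H(τ)`.
Holding for all such `τ`, this says that `A_{n/s}` of the normalized convolution is at most `w(x)`
(`youngTarget_le_iff`), and Tonelli gives `∫ w = M`: this is the modular inequality with `c = 2`.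
The norm inequality follows by applying it to `u / l`.

`A_{n/s}` is a Young function because `H` is concave, so `H⁻¹` is convex, and `A` is convex and
increasing. -/

open Filter Topology

/-! ### Elementary properties of Young functions -/

namespace IsYoungFunction

variable {A : ℝ≥0 → ℝ≥0∞}

/-- Convexity between `0` and `y`. The product form of the monotonicity of `A t / t` stays valid
when `A` takes the values `0` or `∞`. -/
theorem mul_le_mul_of_le (hA : IsYoungFunction A) {x y : ℝ≥0} (hxy : x ≤ y) :
    A x * y ≤ x * A y := by
  rcases eq_or_ne y 0 with rfl | hy
  · simp
  have hle : x / y ≤ 1 := div_le_one_of_le₀ hxy zero_le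
  have h := hA.convex.2 (Set.mem_univ y) (Set.mem_univ (0 : ℝ≥0)) zero_le
    zero_le (add_tsub_cancel_of_le hle)
  rw [smul_zero, add_zero, hA.map_zero, smul_zero, add_zero, smul_eq_mul, div_mul_cancel₀ _ hy,
    ENNReal.smul_def, smul_eq_mul] at h
  calc A x * y ≤ ((x / y : ℝ≥0) : ℝ≥0∞) * A y * y := by gcongr
    _ = ((x / y * y : ℝ≥0) : ℝ≥0∞) * A y := by push_cast; ring
    _ = x * A y := by rw [div_mul_cancel₀ _ hy]

theorem monotone (hA : IsYoungFunction A) : Monotone A := by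
  intro x y hxy
  rcases eq_or_ne y 0 with rfl | hy
  · rw [le_antisymm hxy zero_le]
  have hy' : (y : ℝ≥0∞) ≠ 0 := by simpa using hy
  refine (ENNReal.mul_le_mul_iff_left hy' ENNReal.coe_ne_top).1 ?_
  calc A x * y ≤ x * A y := hA.mul_le_mul_of_le hxy
    _ ≤ A y * y := by rw [mul_comm]; gcongr

theorem exists_lt (hA : IsYoungFunction A) {w : ℝ≥0∞} (hw : w ≠ ∞) : ∃ t, w < A t := by
  obtain ⟨t, ht, hAt⟩ := hA.ne_zero
  obtain ⟨k, hk⟩ := ENNReal.exists_nat_mul_gt hAt hw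
  refine ⟨(k + 1) * t, hk.trans_le ?_⟩
  have h := hA.mul_le_mul_of_le (x := t) (y := (k + 1) * t) (by
    nth_rw 1 [← one_mul t]; gcongr; simp)
  have ht' : (t : ℝ≥0∞) ≠ 0 := by simpa using ht.ne'
  refine (ENNReal.mul_le_mul_iff_right ht' ENNReal.coe_ne_top).1 (le_trans ?_ h)
  calc (t : ℝ≥0∞) * (k * A t) ≤ t * ((k + 1) * A t) := by gcongr; exact le_self_add
    _ = A t * ((k + 1) * t : ℝ≥0) := by push_cast; ring

theorem le_of_forall_lt (hA : IsYoungFunction A) {t : ℝ≥0} {w : ℝ≥0∞}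
    (h : ∀ r < t, A r ≤ w) : A t ≤ w := by
  rcases eq_or_ne t 0 with rfl | ht
  · simp [hA.map_zero]
  have : (𝓝[<] t).NeBot := nhdsLT_neBot_of_exists_lt ⟨0, pos_iff_ne_zero.2 ht⟩
  exact le_of_tendsto (hA.left_cont t) (eventually_mem_nhdsWithin.mono h)

theorem antitone_div (hA : IsYoungFunction A) {x y : ℝ≥0} (hx : 0 < x) (hxy : x ≤ y) :
    (y : ℝ≥0∞) / A y ≤ x / A x := by
  rcases eq_or_ne (A x) 0 with h0 | h0
  · rw [h0, ENNReal.div_zero (by simpa using hx.ne')]; exact le_top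
  rcases eq_or_ne (A y) ∞ with h1 | h1
  · simp [h1]
  have h2 : A x ≠ ∞ := ne_top_of_le_ne_top h1 (hA.monotone hxy)
  have h3 : A y ≠ 0 := fun h => h0 (le_antisymm (h ▸ hA.monotone hxy) zero_le)
  rw [ENNReal.div_le_iff h3 h1, mul_comm, ← mul_div_assoc, ENNReal.le_div_iff_mul_le
    (Or.inl h0) (Or.inl h2), mul_comm, mul_comm (A y)]
  exact hA.mul_le_mul_of_le hxy

theorem extTop_le (hA : IsYoungFunction A) {t : ℝ≥0∞} {τ : ℝ≥0} (h : t ≤ τ) :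
    extTop A t ≤ A τ := by
  lift t to ℝ≥0 using ne_top_of_le_ne_top ENNReal.coe_ne_top h
  simpa [extTop] using hA.monotone (by exact_mod_cast h)

/-- A criterion for `IsYoungFunction` in terms of lower semicontinuity. -/
theorem of_monotone (hconv : ConvexOn ℝ≥0 Set.univ A) (hmono : Monotone A)
    (hlsc : ∀ t w, w < ∞ → (∀ r < t, A r ≤ w) → A t ≤ w) (h_ne_zero : ∃ t : ℝ≥0, 0 < t ∧ A t ≠ 0)
    (h_ne_top : ∃ t : ℝ≥0, 0 < t ∧ A t ≠ ∞) : IsYoungFunction A where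
  convex := hconv
  left_cont t := by
    refine tendsto_order.2 ⟨fun w hw => ?_, fun w hw =>
      eventually_mem_nhdsWithin.mono fun r hr => (hmono (le_of_lt hr)).trans_lt hw⟩
    have : ∃ r < t, w < A r := by
      by_contra! h
      exact hw.not_ge (hlsc t w hw.lt_top h)
    obtain ⟨r, hr, hwr⟩ := this
    filter_upwards [Ioo_mem_nhdsLT hr] with x hx
    exact hwr.trans_le (hmono hx.1.le)
  map_zero := by
    -- At `t = 0` no `r < t` exists, so `hlsc` applies vacuously.
    exact le_antisymm (hlsc 0 0 (by simp) fun r hr => absurd hr not_lt_zero) zero_le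
  ne_zero := h_ne_zero
  ne_top := h_ne_top

end IsYoungFunction

theorem ENNReal.mul_rpow_add_mul_rpow_le {a b : ℝ≥0} (hab : a + b = 1) {r : ℝ} (hr : 0 < r)
    (hr1 : r ≤ 1) (x y : ℝ≥0∞) : a * x ^ r + b * y ^ r ≤ (a * x + b * y) ^ r := by
  have h := ENNReal.rpow_arith_mean_le_arith_mean2_rpow (a : ℝ≥0∞) b (x ^ r) (y ^ r)
    (by exact_mod_cast hab) (p := 1 / r) (by rwa [le_div_iff₀ hr, one_mul])
  rw [← ENNReal.rpow_mul, ← ENNReal.rpow_mul, mul_one_div_cancel hr.ne', ENNReal.rpow_one,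
    ENNReal.rpow_one, one_div] at h
  exact (ENNReal.rpow_inv_le_iff hr).1 h

/-! ### The function `H`, its inverse, and the Young function `A_{n/s}` -/

section Target

variable {n : ℕ} {s : ℝ} {A : ℝ≥0 → ℝ≥0∞}

theorem youngIntegral_add (n : ℕ) (s : ℝ) (A : ℝ≥0 → ℝ≥0∞) {x y : ℝ≥0} (hxy : x ≤ y) :
    youngIntegral n s A y = youngIntegral n s A x +
      ∫⁻ τ in Set.Ico (x : ℝ) y, (ENNReal.ofReal τ / A τ.toNNReal) ^ (s / ((n : ℝ) - s)) := by
  rcases eq_or_ne x 0 with rfl | hx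
  · have : youngIntegral n s A 0 = 0 := by simp [youngIntegral]
    rw [this, zero_add, youngIntegral]
    exact setLIntegral_congr Ioo_ae_eq_Ico
  rw [youngIntegral, youngIntegral, ← lintegral_union measurableSet_Ico
    (Set.disjoint_left.2 fun a ha hb => (ha.2.not_ge hb.1))]
  congr 2
  rw [Set.Ioo_union_Ico_eq_Ioo (by exact_mod_cast pos_iff_ne_zero.2 hx) (by exact_mod_cast hxy)]

theorem youngIntegral_mono (n : ℕ) (s : ℝ) (A : ℝ≥0 → ℝ≥0∞) : Monotone (youngIntegral n s A) := by
  intro x y hxy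
  rw [youngIntegral_add n s A hxy]
  exact le_self_add

theorem exponent_pos (hs : 0 < s) (hsn : s < n) : 0 < s / ((n : ℝ) - s) :=
  div_pos hs (sub_pos.2 hsn)

theorem outer_exponent_pos (hs : 0 < s) (hsn : s < n) : 0 < ((n : ℝ) - s) / n :=
  div_pos (sub_pos.2 hsn) (hs.trans hsn)

theorem youngH_mono (hs : 0 < s) (hsn : s < n) (A : ℝ≥0 → ℝ≥0∞) : Monotone (youngH n s A) :=
  fun _ _ h => ENNReal.rpow_le_rpow (youngIntegral_mono n s A h) (outer_exponent_pos hs hsn).le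

namespace IsYoungFunction

theorem integrand_antitone (hA : IsYoungFunction A) (hs : 0 < s) (hsn : s < n) {x y : ℝ}
    (hx : 0 < x) (hxy : x ≤ y) :
    (ENNReal.ofReal y / A y.toNNReal) ^ (s / ((n : ℝ) - s)) ≤
      (ENNReal.ofReal x / A x.toNNReal) ^ (s / ((n : ℝ) - s)) := by
  refine ENNReal.rpow_le_rpow ?_ (exponent_pos hs hsn).le
  exact hA.antitone_div (Real.toNNReal_pos.2 hx) (Real.toNNReal_le_toNNReal hxy)

theorem lintegral_Ico_le (hA : IsYoungFunction A) (hs : 0 < s) (hsn : s < n) {x y : ℝ≥0}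
    (hx : 0 < x) (hxy : x ≤ y) :
    ∫⁻ τ in Set.Ico (x : ℝ) y, (ENNReal.ofReal τ / A τ.toNNReal) ^ (s / ((n : ℝ) - s)) ≤
      (x / A x) ^ (s / ((n : ℝ) - s)) * (y - x : ℝ≥0) := by
  calc _ ≤ ∫⁻ _ in Set.Ico (x : ℝ) y, (x / A x) ^ (s / ((n : ℝ) - s)) := by
        refine setLIntegral_mono measurable_const fun τ hτ => ?_
        simpa using hA.integrand_antitone hs hsn (x := x) (by exact_mod_cast hx) hτ.1
    _ = _ := by
        rw [setLIntegral_const, Real.volume_Ico, ← NNReal.coe_sub hxy, ENNReal.ofReal_coe_nnreal]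

theorem le_lintegral_Ico (hA : IsYoungFunction A) (hs : 0 < s) (hsn : s < n) {x y : ℝ≥0}
    (hxy : x ≤ y) :
    (y / A y) ^ (s / ((n : ℝ) - s)) * (y - x : ℝ≥0) ≤
      ∫⁻ τ in Set.Ico (x : ℝ) y, (ENNReal.ofReal τ / A τ.toNNReal) ^ (s / ((n : ℝ) - s)) := by
  calc _ = ∫⁻ _ in Set.Ioo (x : ℝ) y, (y / A y) ^ (s / ((n : ℝ) - s)) := by
        rw [setLIntegral_const, Real.volume_Ioo, ← NNReal.coe_sub hxy, ENNReal.ofReal_coe_nnreal]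
    _ ≤ ∫⁻ τ in Set.Ioo (x : ℝ) y, (ENNReal.ofReal τ / A τ.toNNReal) ^ (s / ((n : ℝ) - s)) := by
        refine setLIntegral_mono' measurableSet_Ioo fun τ hτ => ?_
        simpa using hA.integrand_antitone hs hsn (y := y) (x.coe_nonneg.trans_lt hτ.1) hτ.2.le
    _ = _ := setLIntegral_congr Ioo_ae_eq_Ico

/-- The integrand decreases, so the integral over `(0, t)` is at least `t` times its value at `t`;
the powers of `t` then add up to `1`. -/
theorem mul_rpow_le_youngH (hA : IsYoungFunction A) (hs : 0 < s) (hsn : s < n) (t : ℝ≥0) :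
    (t : ℝ≥0∞) * (A t) ^ (-(s / (n : ℝ))) ≤ youngH n s A t := by
  have hn : (0 : ℝ) < n := hs.trans hsn
  have hns : (0 : ℝ) < n - s := sub_pos.2 hsn
  have h := hA.le_lintegral_Ico hs hsn (zero_le : 0 ≤ t)
  rcases eq_or_ne t 0 with rfl | ht
  · simp
  have ht' : (t : ℝ≥0∞) ≠ 0 := by simpa using ht
  have h2 : (t / A t) ^ (s / ((n : ℝ) - s)) * t ≤ youngIntegral n s A t := by
    rw [youngIntegral_add n s A zero_le]
    refine le_trans ?_ (le_add_left h)
    simp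
  refine le_trans (le_of_eq ?_) (ENNReal.rpow_le_rpow h2 (outer_exponent_pos hs hsn).le)
  rw [ENNReal.mul_rpow_of_nonneg _ _ (outer_exponent_pos hs hsn).le, ← ENNReal.rpow_mul,
    show s / ((n : ℝ) - s) * (((n : ℝ) - s) / n) = s / n by field_simp,
    ENNReal.div_rpow_of_nonneg _ _ (by positivity), ENNReal.rpow_neg,
    div_eq_mul_inv (_ ^ _) (_ ^ _), mul_right_comm, ← ENNReal.rpow_add _ _ ht' ENNReal.coe_ne_top,
    show s / (n : ℝ) + ((n : ℝ) - s) / n = 1 by field_simp; ring, ENNReal.rpow_one]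

/-- A zero of `A` at a positive point forces zeros arbitrarily near `0`, where the lower bound for
`H` becomes infinite. -/
theorem pos_of_integral_lt_top (hA : IsYoungFunction A) (hs : 0 < s) (hsn : s < n)
    (hfin : ∃ ε : ℝ≥0, 0 < ε ∧ youngIntegral n s A ε < ∞) {t : ℝ≥0} (ht : 0 < t) : A t ≠ 0 := by
  intro h0
  obtain ⟨ε, hε, hint⟩ := hfin
  have hm : 0 < min ε t := lt_min hε ht
  have hAm : A (min ε t) = 0 := le_antisymm (h0 ▸ hA.monotone (min_le_right _ _)) zero_le
  have h1 := hA.mul_rpow_le_youngH hs hsn (min ε t)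
  rw [hAm, ENNReal.zero_rpow_of_neg (by
    have := hs.trans hsn
    simp only [Left.neg_neg_iff]; positivity), ENNReal.mul_top (by simpa using hm.ne')] at h1
  have h2 : youngH n s A ε < ∞ :=
    ENNReal.rpow_lt_top_of_nonneg (outer_exponent_pos hs hsn).le hint.ne
  exact absurd (h1.trans (youngH_mono hs hsn A (min_le_left _ _))) (not_le.2 h2)

theorem youngH_lt_top (hA : IsYoungFunction A) (hs : 0 < s) (hsn : s < n)
    (hfin : ∃ ε : ℝ≥0, 0 < ε ∧ youngIntegral n s A ε < ∞) (t : ℝ≥0) : youngH n s A t < ∞ := by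
  have hpos : ∀ {t : ℝ≥0}, 0 < t → A t ≠ 0 := hA.pos_of_integral_lt_top hs hsn hfin
  obtain ⟨ε, hε, hint⟩ := hfin
  refine ENNReal.rpow_lt_top_of_nonneg (outer_exponent_pos hs hsn).le (ne_of_lt ?_)
  refine (youngIntegral_mono n s A (le_max_right ε t)).trans_lt ?_
  rw [youngIntegral_add n s A (le_max_left ε t)]
  refine ENNReal.add_lt_top.2 ⟨hint, (hA.lintegral_Ico_le hs hsn hε (le_max_left _ _)).trans_lt ?_⟩
  refine ENNReal.mul_lt_top (ENNReal.rpow_lt_top_of_nonneg (exponent_pos hs hsn).le ?_)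
    ENNReal.coe_lt_top
  exact (ENNReal.div_lt_top ENNReal.coe_ne_top (hpos hε)).ne

/-- A primitive of a decreasing function is concave: the integrals over `[x, z)` and `[z, y)` are
both compared with the integrand's value at `z`. -/
theorem youngIntegral_concave (hA : IsYoungFunction A) (hs : 0 < s) (hsn : s < n)
    {a b x y : ℝ≥0} (hab : a + b = 1) (hxy : x ≤ y) :
    a * youngIntegral n s A x + b * youngIntegral n s A y ≤
      youngIntegral n s A (a * x + b * y) := by
  set z := a * x + b * y with hz
  have hxz : x ≤ z := by
    calc x = a * x + b * x := by rw [← add_mul, hab, one_mul]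
      _ ≤ z := by rw [hz]; gcongr
  have hzy : z ≤ y := by
    calc z ≤ a * y + b * y := by rw [hz]; gcongr
      _ = y := by rw [← add_mul, hab, one_mul]
  have hbal : b * (y - z) = a * (z - x) := by
    have hab' : (a : ℝ) + b = 1 := by exact_mod_cast hab
    have hz' : (z : ℝ) = a * x + b * y := by rw [hz]; push_cast; ring
    apply NNReal.coe_injective
    rw [NNReal.coe_mul, NNReal.coe_mul, NNReal.coe_sub hzy, NNReal.coe_sub hxz]
    have ha' : (a : ℝ) = 1 - b := by linarith
    rw [hz', ha']
    ring
  rcases eq_or_ne z 0 with h0 | h0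
  · have hx0 : x = 0 := le_antisymm (h0 ▸ hxz) zero_le
    have hy : b * y = 0 := by
      have : b * y ≤ 0 := by rw [← h0, hz]; exact le_add_self
      exact le_antisymm this zero_le
    have hI0 : youngIntegral n s A 0 = 0 := by simp [youngIntegral]
    rw [h0, hx0, hI0, mul_zero, zero_add]
    rcases mul_eq_zero.1 hy with h | h <;> simp [h, hI0]
  have h1 := hA.lintegral_Ico_le hs hsn (pos_iff_ne_zero.2 h0) hzy
  have h2 := hA.le_lintegral_Ico hs hsn hxz
  have key : (b : ℝ≥0∞) * ∫⁻ τ in Set.Ico (z : ℝ) y,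
        (ENNReal.ofReal τ / A τ.toNNReal) ^ (s / ((n : ℝ) - s)) ≤
      a * ∫⁻ τ in Set.Ico (x : ℝ) z,
        (ENNReal.ofReal τ / A τ.toNNReal) ^ (s / ((n : ℝ) - s)) := by
    calc _ ≤ (b : ℝ≥0∞) * ((z / A z) ^ (s / ((n : ℝ) - s)) * (y - z : ℝ≥0)) := by gcongr
      _ = (z / A z) ^ (s / ((n : ℝ) - s)) * ((b * (y - z) : ℝ≥0) : ℝ≥0∞) := by
        push_cast; ring
      _ = a * ((z / A z) ^ (s / ((n : ℝ) - s)) * (z - x : ℝ≥0)) := by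
        rw [hbal]; push_cast; ring
      _ ≤ _ := by gcongr
  have hab' : (a : ℝ≥0∞) + b = 1 := by exact_mod_cast hab
  have e1 := youngIntegral_add n s A hxz
  have e2 := youngIntegral_add n s A hzy
  generalize ∫⁻ τ in Set.Ico (z : ℝ) y,
    (ENNReal.ofReal τ / A τ.toNNReal) ^ (s / ((n : ℝ) - s)) = J at e2 key
  generalize ∫⁻ τ in Set.Ico (x : ℝ) z,
    (ENNReal.ofReal τ / A τ.toNNReal) ^ (s / ((n : ℝ) - s)) = K at e1 key
  calc _ = a * youngIntegral n s A x + b * J + b * youngIntegral n s A z := by rw [e2]; ring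
    _ ≤ a * youngIntegral n s A x + a * K + b * youngIntegral n s A z := by gcongr _ + ?_ + _
    _ = (a + b) * youngIntegral n s A z := by rw [← mul_add, ← e1, add_mul]
    _ = youngIntegral n s A z := by rw [hab', one_mul]

theorem youngH_concave (hA : IsYoungFunction A) (hs : 0 < s) (hsn : s < n)
    {a b : ℝ≥0} (hab : a + b = 1) (x y : ℝ≥0) :
    a * youngH n s A x + b * youngH n s A y ≤ youngH n s A (a * x + b * y) := by
  have hn : (0 : ℝ) < n := hs.trans hsn
  refine (ENNReal.mul_rpow_add_mul_rpow_le hab (outer_exponent_pos hs hsn)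
    (by rw [div_le_one hn]; linarith) _ _).trans
    (ENNReal.rpow_le_rpow ?_ (outer_exponent_pos hs hsn).le)
  rcases le_total x y with h | h
  · exact hA.youngIntegral_concave hs hsn hab h
  · rw [add_comm, add_comm (a * x)]
    exact hA.youngIntegral_concave hs hsn (by rwa [add_comm]) h

theorem youngTarget_le_of_le_youngH (hA : IsYoungFunction A) {t τ : ℝ≥0}
    (h : (t : ℝ≥0∞) ≤ youngH n s A τ) : youngTarget n s A t ≤ A τ := by
  exact hA.extTop_le (iInf₂_le τ h)

/-- Sublevel sets of `A ∘ H⁻¹` in terms of `H` alone. Using only `τ` with `A τ > w` strictly avoids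
any continuity of `H`; left-continuity of `A` handles the infimum of these `τ`. Monotonicity,
left-continuity and the final bound all rest on this. -/
theorem youngTarget_le_iff (hA : IsYoungFunction A) (hs : 0 < s) (hsn : s < n) {w : ℝ≥0∞}
    (hw : w < ∞) {t : ℝ≥0} :
    youngTarget n s A t ≤ w ↔ ∀ τ, w < A τ → (t : ℝ≥0∞) ≤ youngH n s A τ := by
  constructor
  · intro h τ hτ
    have hne : youngHInv n s A t ≠ ∞ := by
      intro htop
      rw [youngTarget, extTop, if_pos htop] at h
      exact hw.not_ge h
    rw [youngTarget, extTop, if_neg hne] at h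
    have hlt : youngHInv n s A t < τ := by
      by_contra! hge
      have := hA.monotone ((ENNReal.le_toNNReal_of_coe_le hge hne))
      exact (this.trans h).not_gt hτ
    obtain ⟨σ, hσ⟩ := iInf_lt_iff.1 hlt
    obtain ⟨hσ1, hσ2⟩ := iInf_lt_iff.1 hσ
    exact hσ1.trans (youngH_mono hs hsn A (by exact_mod_cast hσ2.le))
  · intro h
    obtain ⟨τ₀, hτ₀⟩ := hA.exists_lt hw.ne
    set σ := sInf {τ | w < A τ} with hσ
    have hA_le : A σ ≤ w := hA.le_of_forall_lt fun r hr =>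
      not_lt.1 fun hlt : w < A r => (csInf_le (OrderBot.bddBelow {τ | w < A τ}) hlt).not_gt hr
    have hle : youngHInv n s A t ≤ σ := by
      refine ENNReal.le_of_forall_pos_le_add fun ε hε _ => ?_
      obtain ⟨τ, hτ, hτσ⟩ := exists_lt_of_csInf_lt ⟨τ₀, hτ₀⟩ (lt_add_of_pos_right σ hε)
      exact (iInf₂_le τ (h τ hτ)).trans (by exact_mod_cast hτσ.le)
    exact (hA.extTop_le hle).trans hA_le

theorem youngTarget_mono (hA : IsYoungFunction A) (hs : 0 < s) (hsn : s < n) :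
    Monotone (youngTarget n s A) := by
  intro x y hxy
  rcases eq_top_or_lt_top (youngTarget n s A y) with h | h
  · rw [h]; exact le_top
  · exact (hA.youngTarget_le_iff hs hsn h).2 fun τ hτ =>
      le_trans (by exact_mod_cast hxy) ((hA.youngTarget_le_iff hs hsn h).1 le_rfl τ hτ)

theorem _root_.exists_youngTarget_eq {x : ℝ≥0} (hx : youngTarget n s A x < ∞) :
    ∃ σ : ℝ≥0, youngHInv n s A x = σ ∧ youngTarget n s A x = A σ := by
  have hne : youngHInv n s A x ≠ ∞ := by
    intro htop
    rw [youngTarget, extTop, if_pos htop] at hx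
    exact hx.ne rfl
  exact ⟨_, (ENNReal.coe_toNNReal hne).symm, by rw [youngTarget, extTop, if_neg hne]⟩

theorem youngHInv_convex (hA : IsYoungFunction A) (hs : 0 < s) (hsn : s < n)
    {a b : ℝ≥0} (hab : a + b = 1) {x y σ ρ : ℝ≥0} (hσ : youngHInv n s A x = σ)
    (hρ : youngHInv n s A y = ρ) :
    youngHInv n s A (a * x + b * y) ≤ ((a * σ + b * ρ : ℝ≥0) : ℝ≥0∞) := by
  have key : ∀ {x σ ε : ℝ≥0}, 0 < ε → youngHInv n s A x = σ →
      (x : ℝ≥0∞) ≤ youngH n s A (σ + ε) := by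
    intro x σ ε hε h
    have hlt : youngHInv n s A x < (σ + ε : ℝ≥0) := by
      rw [h]; exact ENNReal.coe_lt_coe.2 (lt_add_of_pos_right σ hε)
    obtain ⟨τ, hτ⟩ := iInf_lt_iff.1 hlt
    obtain ⟨hτ1, hτ2⟩ := iInf_lt_iff.1 hτ
    exact hτ1.trans (youngH_mono hs hsn A (by exact_mod_cast hτ2.le))
  -- The infimum defining `H⁻¹` is not assumed attained, so the points are shifted by `ε`.
  refine ENNReal.le_of_forall_pos_le_add fun ε hε _ => ?_
  have h := hA.youngH_concave hs hsn hab (σ + ε) (ρ + ε)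
  have h2 : ((a * x + b * y : ℝ≥0) : ℝ≥0∞) ≤ youngH n s A (a * (σ + ε) + b * (ρ + ε)) := by
    push_cast
    refine le_trans ?_ h
    gcongr
    · exact key hε hσ
    · exact key hε hρ
  refine le_trans (iInf₂_le (a * (σ + ε) + b * (ρ + ε)) h2) (le_of_eq ?_)
  rw [← ENNReal.coe_add, show a * (σ + ε) + b * (ρ + ε) = a * σ + b * ρ + (a + b) * ε by ring,
    hab, one_mul]

theorem youngTarget_convexOn (hA : IsYoungFunction A) (hs : 0 < s) (hsn : s < n) :
    ConvexOn ℝ≥0 Set.univ (youngTarget n s A) := by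
  refine ⟨convex_univ, fun x _ y _ a b _ _ hab => ?_⟩
  simp only [smul_eq_mul, ENNReal.smul_def]
  rcases eq_or_ne a 0 with rfl | ha
  · rw [zero_add] at hab; simp [hab]
  rcases eq_or_ne b 0 with rfl | hb
  · rw [add_zero] at hab; simp [hab]
  rcases eq_top_or_lt_top (youngTarget n s A x) with hx | hx
  · rw [hx, ENNReal.mul_top (by simpa using ha), top_add]; exact le_top
  rcases eq_top_or_lt_top (youngTarget n s A y) with hy | hy
  · rw [hy, ENNReal.mul_top (by simpa using hb), add_top]; exact le_top
  obtain ⟨σ, hσ, hσ'⟩ := exists_youngTarget_eq hx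
  obtain ⟨ρ, hρ, hρ'⟩ := exists_youngTarget_eq hy
  have h := hA.youngHInv_convex hs hsn hab hσ hρ
  rw [hσ', hρ']
  refine (hA.extTop_le h).trans ?_
  simpa [ENNReal.smul_def] using
    hA.convex.2 (Set.mem_univ σ) (Set.mem_univ ρ) zero_le zero_le hab

theorem youngTarget (hA : IsYoungFunction A) (hs : 0 < s) (hsn : s < n)
    (hfin : ∃ ε : ℝ≥0, 0 < ε ∧ youngIntegral n s A ε < ∞) :
    IsYoungFunction (youngTarget n s A) := by
  refine of_monotone (hA.youngTarget_convexOn hs hsn) (hA.youngTarget_mono hs hsn) ?_ ?_ ?_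
  · intro t w hw h
    refine (hA.youngTarget_le_iff hs hsn hw).2 fun τ hτ => ?_
    refine ENNReal.le_of_forall_nnreal_lt fun r hr => ?_
    exact (hA.youngTarget_le_iff hs hsn hw).1 (h r (by exact_mod_cast hr)) τ hτ
  -- Were `A_{n/s}` zero on `(0, ∞)`, then `A 1 > 0` would force `H(1)` above every real.
  · by_contra! h
    have htop : youngH n s A 1 = ∞ := by
      refine ENNReal.eq_top_of_forall_nnreal_le fun r => ?_
      have hr := (hA.youngTarget_le_iff hs hsn ENNReal.zero_lt_top).1
        (h (r + 1) (by positivity)).le 1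
        (pos_iff_ne_zero.2 (hA.pos_of_integral_lt_top hs hsn hfin one_pos))
      exact le_trans (by exact_mod_cast (le_add_of_nonneg_right zero_le_one)) hr
    exact (hA.youngH_lt_top hs hsn hfin 1).ne htop
  -- The witness is `H(τ)` with `A τ < ∞`, positive and finite.
  · obtain ⟨τ, hτ, hAτ⟩ := hA.ne_top
    have hH : 0 < youngH n s A τ := by
      refine lt_of_lt_of_le ?_ (hA.mul_rpow_le_youngH hs hsn τ)
      refine ENNReal.mul_pos (by simpa using hτ.ne') (ENNReal.rpow_pos ?_ hAτ).ne'
      exact pos_iff_ne_zero.2 (hA.pos_of_integral_lt_top hs hsn hfin hτ)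
    have hfinH := hA.youngH_lt_top hs hsn hfin τ
    refine ⟨(youngH n s A τ).toNNReal, ENNReal.toNNReal_pos hH.ne' hfinH.ne,
      ne_top_of_le_ne_top hAτ (hA.youngTarget_le_of_le_youngH ?_)⟩
    exact (ENNReal.coe_toNNReal hfinH.ne).le

end IsYoungFunction

end Target

/-! ### Two forms of Hölder's inequality -/

section Holder

variable {n : ℕ} {s : ℝ} {X : Type*} [MeasurableSpace X] {μ : Measure X}

theorem holderConjugate_div (hs : 0 < s) (hsn : s < n) :
    ((n : ℝ) / s).HolderConjugate ((n : ℝ) / ((n : ℝ) - s)) := by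
  have hn : (0 : ℝ) < n := hs.trans hsn
  have hns : (0 : ℝ) < n - s := sub_pos.2 hsn
  rw [Real.holderConjugate_iff]
  refine ⟨(one_lt_div hs).2 hsn, ?_⟩
  field_simp
  ring

theorem lintegral_rpow_mul_le (hs : 0 < s) (hsn : s < n) {f g : X → ℝ≥0∞}
    (hf : AEMeasurable f μ) (hg : AEMeasurable g μ) :
    ∫⁻ y, f y ^ (s / (n : ℝ)) * g y ∂μ ≤ (∫⁻ y, f y ∂μ) ^ (s / (n : ℝ)) *
      (∫⁻ y, g y ^ ((n : ℝ) / ((n : ℝ) - s)) ∂μ) ^ (((n : ℝ) - s) / n) := by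
  have hn : (0 : ℝ) < n := hs.trans hsn
  have h := ENNReal.lintegral_mul_le_Lp_mul_Lq μ (holderConjugate_div hs hsn)
    (hf.pow_const (s / (n : ℝ))) hg
  simp only [one_div_div, ← ENNReal.rpow_mul, div_mul_div_cancel₀ hn.ne', div_self hs.ne',
    ENNReal.rpow_one, Pi.mul_apply] at h
  exact h

/-- Hölder applied to `f^(s/n)` and `f^((n-s)/n) · g`. -/
theorem lintegral_mul_le_rpow (hs : 0 < s) (hsn : s < n) {f g : X → ℝ≥0∞}
    (hf : AEMeasurable f μ) (hg : AEMeasurable g μ) :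
    ∫⁻ y, f y * g y ∂μ ≤ (∫⁻ y, f y ∂μ) ^ (s / (n : ℝ)) *
      (∫⁻ y, f y * g y ^ ((n : ℝ) / ((n : ℝ) - s)) ∂μ) ^ (((n : ℝ) - s) / n) := by
  have hn : (0 : ℝ) < n := hs.trans hsn
  have hns : (0 : ℝ) < n - s := sub_pos.2 hsn
  have h := lintegral_rpow_mul_le (μ := μ) hs hsn hf ((hf.pow_const (((n : ℝ) - s) / n)).mul hg)
  refine le_trans (le_of_eq ?_) (h.trans (le_of_eq ?_))
  · refine lintegral_congr fun y => ?_
    rw [Pi.mul_apply, ← mul_assoc, ← ENNReal.rpow_add_of_nonneg _ _ (by positivity) (by positivity),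
      show s / (n : ℝ) + ((n : ℝ) - s) / n = 1 by field_simp; ring, ENNReal.rpow_one]
  · congr 2
    refine lintegral_congr fun y => ?_
    rw [Pi.mul_apply, ENNReal.mul_rpow_of_nonneg _ _ (by positivity), ← ENNReal.rpow_mul,
      show ((n : ℝ) - s) / n * (n / (n - s)) = 1 by field_simp, ENNReal.rpow_one]

end Holder

/-! ### The pointwise estimate -/

namespace IsYoungFunction

variable {n : ℕ} {s : ℝ} {A : ℝ≥0 → ℝ≥0∞}

/-- For `r ≤ τ` the first term suffices, by the lower bound for `H(r)`; for `r > τ` the second does,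
since `t / A t` decreases. -/
theorem coe_le_add (hA : IsYoungFunction A) (hs : 0 < s) (hsn : s < n)
    (hpos : ∀ t : ℝ≥0, 0 < t → A t ≠ 0) {τ r : ℝ≥0} (hτ : 0 < τ) (hr : A r ≠ ∞) :
    (r : ℝ≥0∞) ≤ A r ^ (s / (n : ℝ)) * youngH n s A τ + τ / A τ * A r := by
  rcases eq_or_ne r 0 with rfl | hr0
  · simp
  rcases le_or_gt r τ with h | h
  · have h0 := hpos r (pos_iff_ne_zero.2 hr0)
    refine le_add_right ?_
    calc (r : ℝ≥0∞) = A r ^ (s / (n : ℝ)) * (r * A r ^ (-(s / (n : ℝ)))) := by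
          rw [mul_left_comm, ← ENNReal.rpow_add _ _ h0 hr, add_neg_cancel, ENNReal.rpow_zero,
            mul_one]
      _ ≤ A r ^ (s / (n : ℝ)) * youngH n s A τ := by
          gcongr
          exact (hA.mul_rpow_le_youngH hs hsn r).trans (youngH_mono hs hsn A h)
  · refine le_add_left ?_
    have h1 : A τ ≠ ∞ := ne_top_of_le_ne_top hr (hA.monotone h.le)
    rw [mul_comm, ← mul_div_assoc, ENNReal.le_div_iff_mul_le (Or.inl (hpos τ hτ)) (Or.inl h1),
      mul_comm, mul_comm (A r)]
    exact hA.mul_le_mul_of_le h.le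

section

variable {X : Type*} [MeasurableSpace X] {μ : Measure X} {r : X → ℝ≥0} {g : X → ℝ≥0∞}

theorem lintegral_mul_le (hA : IsYoungFunction A) (hs : 0 < s) (hsn : s < n)
    (hpos : ∀ t : ℝ≥0, 0 < t → A t ≠ 0) (hr : AEMeasurable r μ) (hg : AEMeasurable g μ)
    (hM : ∫⁻ y, A (r y) ∂μ ≠ ∞) {τ : ℝ≥0} (hτ : 0 < τ) :
    ∫⁻ y, r y * g y ∂μ ≤ (∫⁻ y, A (r y) ∂μ) ^ (s / (n : ℝ)) *
      (youngH n s A τ * (∫⁻ y, g y ^ ((n : ℝ) / ((n : ℝ) - s)) ∂μ) ^ (((n : ℝ) - s) / n) +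
        τ / A τ *
          (∫⁻ y, A (r y) * g y ^ ((n : ℝ) / ((n : ℝ) - s)) ∂μ) ^ (((n : ℝ) - s) / n)) := by
  have hψ : AEMeasurable (fun y => A (r y)) μ := hA.monotone.measurable.comp_aemeasurable hr
  have h1 := lintegral_rpow_mul_le hs hsn hψ hg
  have h2 := lintegral_mul_le_rpow hs hsn hψ hg
  calc ∫⁻ y, r y * g y ∂μ
      ≤ ∫⁻ y, youngH n s A τ * (A (r y) ^ (s / (n : ℝ)) * g y) +
          τ / A τ * (A (r y) * g y) ∂μ := by
        refine lintegral_mono_ae ?_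
        filter_upwards [ae_lt_top' hψ hM] with y hy
        calc (r y : ℝ≥0∞) * g y
            ≤ (A (r y) ^ (s / (n : ℝ)) * youngH n s A τ + τ / A τ * A (r y)) * g y := by
              gcongr
              exact hA.coe_le_add hs hsn hpos hτ hy.ne
          _ = _ := by ring
    _ = youngH n s A τ * ∫⁻ y, A (r y) ^ (s / (n : ℝ)) * g y ∂μ +
          τ / A τ * ∫⁻ y, A (r y) * g y ∂μ := by
        have hm : AEMeasurable (fun y => A (r y) ^ (s / (n : ℝ)) * g y) μ :=
          (hψ.pow_const _).mul hg
        rw [lintegral_add_left' (hm.const_mul _)]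
        congr 1
        · exact lintegral_const_mul'' _ hm
        · exact lintegral_const_mul'' _ (hψ.mul hg)
    _ ≤ _ := by
        refine (add_le_add (mul_le_mul_right h1 _) (mul_le_mul_right h2 _)).trans (le_of_eq ?_)
        ring

/-- The condition `w < A τ` makes the second term no larger than the first, whence the factor `2`.
-/
theorem lintegral_mul_le_two_mul (hA : IsYoungFunction A) (hs : 0 < s) (hsn : s < n)
    (hpos : ∀ t : ℝ≥0, 0 < t → A t ≠ 0) (hr : AEMeasurable r μ) (hg : AEMeasurable g μ)
    (hM : ∫⁻ y, A (r y) ∂μ ≠ ∞) {w : ℝ≥0∞}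
    (hw : ∫⁻ y, A (r y) * g y ^ ((n : ℝ) / ((n : ℝ) - s)) ∂μ ≤
      w * ∫⁻ y, g y ^ ((n : ℝ) / ((n : ℝ) - s)) ∂μ) {τ : ℝ≥0} (hτ : w < A τ) :
    ∫⁻ y, r y * g y ∂μ ≤
      2 * (∫⁻ y, g y ^ ((n : ℝ) / ((n : ℝ) - s)) ∂μ) ^ (((n : ℝ) - s) / n) *
        (∫⁻ y, A (r y) ∂μ) ^ (s / (n : ℝ)) * youngH n s A τ := by
  have hn : (0 : ℝ) < n := hs.trans hsn
  have hns : (0 : ℝ) < n - s := sub_pos.2 hsn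
  have hτ0 : 0 < τ := by
    rw [pos_iff_ne_zero]
    rintro rfl
    simp [hA.map_zero] at hτ
  have key : τ / A τ * w ^ (((n : ℝ) - s) / n) ≤ youngH n s A τ := by
    refine le_trans ?_ (hA.mul_rpow_le_youngH hs hsn τ)
    rcases eq_or_ne (A τ) ∞ with h | h
    · simp [h]
    calc τ / A τ * w ^ (((n : ℝ) - s) / n) ≤ τ / A τ * A τ ^ (((n : ℝ) - s) / n) := by gcongr
      _ = τ * A τ ^ (-(s / (n : ℝ))) := by
        rw [div_eq_mul_inv, mul_assoc, ← ENNReal.rpow_neg_one,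
          ← ENNReal.rpow_add _ _ (hpos τ hτ0) h]
        congr 2
        field_simp
        ring
  refine (hA.lintegral_mul_le hs hsn hpos hr hg hM hτ0).trans ?_
  set N := ∫⁻ y, g y ^ ((n : ℝ) / ((n : ℝ) - s)) ∂μ
  set M := ∫⁻ y, A (r y) ∂μ
  calc _ ≤ M ^ (s / (n : ℝ)) * (youngH n s A τ * N ^ (((n : ℝ) - s) / n) +
        τ / A τ * (w * N) ^ (((n : ℝ) - s) / n)) := by gcongr
    _ = M ^ (s / (n : ℝ)) * (youngH n s A τ * N ^ (((n : ℝ) - s) / n) +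
        τ / A τ * w ^ (((n : ℝ) - s) / n) * N ^ (((n : ℝ) - s) / n)) := by
      rw [ENNReal.mul_rpow_of_nonneg _ _ (by positivity), mul_assoc]
    _ ≤ M ^ (s / (n : ℝ)) * (youngH n s A τ * N ^ (((n : ℝ) - s) / n) +
        youngH n s A τ * N ^ (((n : ℝ) - s) / n)) := by gcongr
    _ = _ := by ring

/-- For finite `w` some `τ` has `A τ > w`, and finiteness of `H τ` excludes `y = ∞`. -/
theorem extTop_youngTarget_le (hA : IsYoungFunction A) (hs : 0 < s) (hsn : s < n)
    (hH : ∀ t, youngH n s A t < ∞) {w y : ℝ≥0∞}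
    (h : ∀ τ, w < A τ → y ≤ youngH n s A τ) : extTop (_root_.youngTarget n s A) y ≤ w := by
  rcases eq_top_or_lt_top w with rfl | hw
  · exact le_top
  obtain ⟨τ, hτ⟩ := hA.exists_lt hw.ne
  lift y to ℝ≥0 using ne_top_of_le_ne_top (hH τ).ne (h τ hτ)
  simpa [extTop] using (hA.youngTarget_le_iff hs hsn hw).2 h

theorem extTop_youngTarget_lintegral_le (hA : IsYoungFunction A) (hs : 0 < s) (hsn : s < n)
    (hpos : ∀ t : ℝ≥0, 0 < t → A t ≠ 0) (hH : ∀ t, youngH n s A t < ∞)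
    (hr : AEMeasurable r μ) (hg : AEMeasurable g μ)
    (hM : ∫⁻ y, A (r y) ∂μ ≠ ∞)
    (hN : ∫⁻ y, g y ^ ((n : ℝ) / ((n : ℝ) - s)) ∂μ ≠ ∞)
    (hN0 : ∫⁻ y, g y ^ ((n : ℝ) / ((n : ℝ) - s)) ∂μ ≠ 0) :
    extTop (_root_.youngTarget n s A) ((∫⁻ y, r y * g y ∂μ) /
      (2 * (∫⁻ y, g y ^ ((n : ℝ) / ((n : ℝ) - s)) ∂μ) ^ (((n : ℝ) - s) / n) *
        (∫⁻ y, A (r y) ∂μ) ^ (s / (n : ℝ)))) ≤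
      (∫⁻ y, A (r y) * g y ^ ((n : ℝ) / ((n : ℝ) - s)) ∂μ) /
        ∫⁻ y, g y ^ ((n : ℝ) / ((n : ℝ) - s)) ∂μ := by
  have hn : (0 : ℝ) < n := hs.trans hsn
  have hns : (0 : ℝ) < n - s := sub_pos.2 hsn
  refine hA.extTop_youngTarget_le hs hsn hH fun τ hτ => ?_
  refine ENNReal.div_le_of_le_mul' (hA.lintegral_mul_le_two_mul hs hsn hpos hr hg hM ?_ hτ)
  rw [ENNReal.div_mul_cancel hN0 hN]

end

end IsYoungFunction

/-! ### Integration over `x`: the modular inequality and a.e. convergence -/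

section Convolution

variable {n : ℕ} {s : ℝ} {A : ℝ≥0 → ℝ≥0∞} {r : EuclideanSpace ℝ (Fin n) → ℝ≥0}
  {g : EuclideanSpace ℝ (Fin n) → ℝ≥0∞}

theorem aemeasurable_comp_sub {G : Type*} [AddGroup G] [MeasurableSpace G] [MeasurableAdd₂ G]
    [MeasurableNeg G] {μ : Measure G} [SFinite μ] {f h : G → ℝ≥0∞}
    (hf : AEMeasurable f μ) (hh : AEMeasurable h μ) [μ.IsAddRightInvariant] :
    AEMeasurable (fun p : G × G => f p.2 * h (p.1 - p.2)) (μ.prod μ) :=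
  hf.comp_snd.mul
    (hh.comp_quasiMeasurePreserving (quasiMeasurePreserving_sub_of_right_invariant μ μ))

theorem aemeasurable_comp_const_sub {G : Type*} [AddGroup G] [MeasurableSpace G]
    [MeasurableAdd₂ G] [MeasurableNeg G] {μ : Measure G} [SFinite μ] {h : G → ℝ≥0∞}
    (hh : AEMeasurable h μ) [μ.IsAddRightInvariant] (x : G) :
    AEMeasurable (fun y => h (x - y)) μ :=
  hh.comp_quasiMeasurePreserving (quasiMeasurePreserving_sub_left_of_right_invariant μ x)

theorem lintegral_lintegral_mul_sub {f h : EuclideanSpace ℝ (Fin n) → ℝ≥0∞}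
    (hf : AEMeasurable f volume) (hh : AEMeasurable h volume) :
    ∫⁻ x, ∫⁻ y, f y * h (x - y) = (∫⁻ y, f y) * ∫⁻ y, h y := by
  rw [lintegral_lintegral_swap (aemeasurable_comp_sub hf hh), ← lintegral_mul_const'' _ hf]
  refine lintegral_congr fun y => ?_
  have hm : AEMeasurable (fun x => h (x - y)) volume := (hh.comp_quasiMeasurePreserving
    (measurePreserving_sub_right volume y).quasiMeasurePreserving)
  rw [lintegral_const_mul'' _ hm, lintegral_sub_right_eq_self]

theorem lintegral_mul_sub_eq_zero {r g : EuclideanSpace ℝ (Fin n) → ℝ≥0∞}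
    (hr : AEMeasurable r volume) (hg : AEMeasurable g volume) {p : ℝ} (hp : 0 < p)
    (h0 : ∫⁻ y, g y ^ p = 0) (x : EuclideanSpace ℝ (Fin n)) : ∫⁻ y, r y * g (x - y) = 0 := by
  have hgx := aemeasurable_comp_const_sub hg x
  have hm : AEMeasurable (fun y => r y * g (x - y)) volume := hr.mul hgx
  rw [lintegral_eq_zero_iff' hm]
  rw [← lintegral_sub_left_eq_self _ x, lintegral_eq_zero_iff' (hgx.pow_const p)] at h0
  filter_upwards [h0] with y hy
  have : g (x - y) = 0 := (ENNReal.rpow_eq_zero_iff_of_pos hp).1 hy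
  simp [this]

namespace IsYoungFunction

theorem extTop_mono (hA : IsYoungFunction A) : Monotone (extTop A) := by
  intro x y hxy
  rcases eq_or_ne y ∞ with rfl | hy
  · simp [extTop]
  · lift y to ℝ≥0 using hy
    simpa [extTop] using hA.extTop_le hxy

/-- The pointwise bound is the convolution of `A(r)` with the probability density `g^p / N`, whose
total mass is that of `A(r)`. The case of zero modular is included, the quotient then being `0 / 0 =
0`. -/
theorem lintegral_extTop_le (hA : IsYoungFunction A) (hs : 0 < s) (hsn : s < n)
    (hpos : ∀ t : ℝ≥0, 0 < t → A t ≠ 0) (hH : ∀ t, youngH n s A t < ∞)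
    (hr : AEMeasurable r volume) (hg : AEMeasurable g volume)
    (hM : ∫⁻ y, A (r y) ≠ ∞)
    (hN : ∫⁻ y, g y ^ ((n : ℝ) / ((n : ℝ) - s)) ≠ ∞)
    (hN0 : ∫⁻ y, g y ^ ((n : ℝ) / ((n : ℝ) - s)) ≠ 0) :
    ∫⁻ x, extTop (_root_.youngTarget n s A) ((∫⁻ y, r y * g (x - y)) /
      (2 * (∫⁻ y, g y ^ ((n : ℝ) / ((n : ℝ) - s))) ^ (((n : ℝ) - s) / n) *
        (∫⁻ y, A (r y)) ^ (s / (n : ℝ)))) ≤ ∫⁻ y, A (r y) := by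
  have hψ : AEMeasurable (fun y => A (r y)) volume := hA.monotone.measurable.comp_aemeasurable hr
  have hgp := hg.pow_const ((n : ℝ) / ((n : ℝ) - s))
  have hx (x : EuclideanSpace ℝ (Fin n)) :
      ∫⁻ y, g (x - y) ^ ((n : ℝ) / ((n : ℝ) - s)) = ∫⁻ y, g y ^ ((n : ℝ) / ((n : ℝ) - s)) :=
    lintegral_sub_left_eq_self (fun y => g y ^ ((n : ℝ) / ((n : ℝ) - s))) x
  calc _ ≤ ∫⁻ x, (∫⁻ y, A (r y) * g (x - y) ^ ((n : ℝ) / ((n : ℝ) - s))) /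
        ∫⁻ y, g y ^ ((n : ℝ) / ((n : ℝ) - s)) := by
        refine lintegral_mono fun x => ?_
        have h := hA.extTop_youngTarget_lintegral_le hs hsn hpos hH hr
          (aemeasurable_comp_const_sub hg x) hM (by rwa [hx]) (by rwa [hx])
        rwa [hx] at h
    _ = ∫⁻ y, A (r y) := by
        simp_rw [div_eq_mul_inv _ (∫⁻ y, g y ^ ((n : ℝ) / ((n : ℝ) - s)))]
        rw [lintegral_mul_const' _ _ (ENNReal.inv_ne_top.2 hN0),
          lintegral_lintegral_mul_sub hψ hgp, mul_assoc, ENNReal.mul_inv_cancel hN0 hN, mul_one]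

/-- Any fixed level bounds the integral by finite quantities for a.e. `x`; `τ = 1` is used. -/
theorem ae_lintegral_mul_sub_lt_top (hA : IsYoungFunction A) (hs : 0 < s) (hsn : s < n)
    (hpos : ∀ t : ℝ≥0, 0 < t → A t ≠ 0) (hH : ∀ t, youngH n s A t < ∞)
    (hr : AEMeasurable r volume) (hg : AEMeasurable g volume) (hM : ∫⁻ y, A (r y) ≠ ∞)
    (hN : ∫⁻ y, g y ^ ((n : ℝ) / ((n : ℝ) - s)) ≠ ∞) :
    ∀ᵐ x, ∫⁻ y, r y * g (x - y) < ∞ := by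
  have hn : (0 : ℝ) < n := hs.trans hsn
  have hns : (0 : ℝ) < n - s := sub_pos.2 hsn
  have hψ : AEMeasurable (fun y => A (r y)) volume := hA.monotone.measurable.comp_aemeasurable hr
  have hgp := hg.pow_const ((n : ℝ) / ((n : ℝ) - s))
  have hW : ∀ᵐ x, ∫⁻ y, A (r y) * g (x - y) ^ ((n : ℝ) / ((n : ℝ) - s)) < ∞ := by
    refine ae_lt_top' (aemeasurable_comp_sub hψ hgp).lintegral_prod_right' ?_
    rw [lintegral_lintegral_mul_sub hψ hgp]
    exact ENNReal.mul_ne_top hM hN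
  filter_upwards [hW] with x hx
  refine (hA.lintegral_mul_le hs hsn hpos hr (aemeasurable_comp_const_sub hg x) hM
    one_pos).trans_lt ?_
  have h1 : ∫⁻ y, g (x - y) ^ ((n : ℝ) / ((n : ℝ) - s)) ≠ ∞ := by
    rwa [lintegral_sub_left_eq_self (fun y => g y ^ ((n : ℝ) / ((n : ℝ) - s))) x]
  have h2 := (ENNReal.div_lt_top ENNReal.coe_ne_top (hpos 1 one_pos) : ((1 : ℝ≥0) : ℝ≥0∞) / A 1 < ∞)
  refine ENNReal.mul_lt_top (ENNReal.rpow_lt_top_of_nonneg (by positivity) hM) ?_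
  exact ENNReal.add_lt_top.2
    ⟨ENNReal.mul_lt_top (hH 1) (ENNReal.rpow_lt_top_of_nonneg (by positivity) h1),
      ENNReal.mul_lt_top h2 (ENNReal.rpow_lt_top_of_nonneg (by positivity) hx.ne)⟩

end IsYoungFunction

variable {u v : EuclideanSpace ℝ (Fin n) → ℝ}

theorem enorm_realConv_le (u v : EuclideanSpace ℝ (Fin n) → ℝ) (x : EuclideanSpace ℝ (Fin n)) :
    ‖realConv u v x‖ₑ ≤ ∫⁻ y, ‖u y‖ₑ * ‖v (x - y)‖ₑ := by
  refine (enorm_integral_le_lintegral_enorm _).trans (le_of_eq ?_)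
  simp [enorm_mul]

theorem aestronglyMeasurable_realConv (hu : AEStronglyMeasurable u volume)
    (hv : AEStronglyMeasurable v volume) : AEStronglyMeasurable (realConv u v) volume :=
  (hu.convolution_integrand (ContinuousLinearMap.mul ℝ ℝ) hv).integral_prod_right'

theorem luxemburgNorm_zero {X : Type*} [MeasureSpace X] {B : ℝ≥0 → ℝ≥0∞} (hB : B 0 = 0) {f : X → ℝ}
    (hf : ∀ x, f x = 0) : luxemburgNorm B f = 0 := by
  refine le_antisymm (ENNReal.le_of_forall_pos_le_add fun ε hε _ => ?_) zero_le
  rw [zero_add]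
  exact iInf₂_le ε ⟨hε, by simp [hf, hB]⟩

theorem eLpNorm_eq_rpow (hs : 0 < s) (hsn : s < n) (v : EuclideanSpace ℝ (Fin n) → ℝ) :
    eLpNorm v (ENNReal.ofReal ((n : ℝ) / ((n : ℝ) - s))) volume =
      (∫⁻ y, ‖v y‖ₑ ^ ((n : ℝ) / ((n : ℝ) - s))) ^ (((n : ℝ) - s) / n) := by
  have hn : (0 : ℝ) < n := hs.trans hsn
  have hns : (0 : ℝ) < n - s := sub_pos.2 hsn
  have hp : 0 < (n : ℝ) / (n - s) := by positivity
  rw [eLpNorm_eq_lintegral_rpow_enorm_toReal (by simpa using hp) ENNReal.ofReal_ne_top,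
    ENNReal.toReal_ofReal hp.le, one_div_div]

end Convolution

/-! ### The main theorem -/

theorem theorem4p3 (n : ℕ) (s : ℝ) (hs : 0 < s) (hsn : s < (n : ℝ)) :
    ∃ c : ℝ≥0, 0 < c ∧
      ∀ A : ℝ≥0 → ℝ≥0∞, IsYoungFunction A →
        (∃ ε : ℝ≥0, 0 < ε ∧ youngIntegral n s A ε < ∞) →
        IsYoungFunction (youngTarget n s A) ∧
        ∀ u v : EuclideanSpace ℝ (Fin n) → ℝ,
          MemOrlicz A u →
          MemLp v (ENNReal.ofReal ((n : ℝ) / ((n : ℝ) - s))) volume →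
          (∀ᵐ x ∂(volume : Measure (EuclideanSpace ℝ (Fin n))),
            ConvolutionExistsAt u v x (ContinuousLinearMap.mul ℝ ℝ) volume) ∧
          MemOrlicz (youngTarget n s A) (realConv u v) ∧
          luxemburgNorm (youngTarget n s A) (realConv u v) ≤
            (c : ℝ≥0∞) * eLpNorm v (ENNReal.ofReal ((n : ℝ) / ((n : ℝ) - s))) volume *
              luxemburgNorm A u ∧
          ∫⁻ x, extTop (youngTarget n s A)
              (‖realConv u v x‖ₑ /
                ((c : ℝ≥0∞) * eLpNorm v (ENNReal.ofReal ((n : ℝ) / ((n : ℝ) - s))) volume *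
                  orliczModular A u ^ (s / (n : ℝ)))) ≤
            orliczModular A u := by
  refine ⟨2, two_pos, fun A hA hfin => ?_⟩
  have hB := hA.youngTarget hs hsn hfin
  have hpos : ∀ t : ℝ≥0, 0 < t → A t ≠ 0 := fun t => hA.pos_of_integral_lt_top hs hsn hfin
  have hH := hA.youngH_lt_top hs hsn hfin
  have hn : (0 : ℝ) < n := hs.trans hsn
  have hns : (0 : ℝ) < n - s := sub_pos.2 hsn
  refine ⟨hB, fun u v hu hv => ?_⟩
  have hr (l : ℝ≥0) : AEMeasurable (fun y => ‖u y‖₊ / l) volume := hu.1.nnnorm.aemeasurable.div_const l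
  have hg : AEMeasurable (fun y => ‖v y‖ₑ) volume := hv.1.enorm
  have hvN := hv.2
  rw [eLpNorm_eq_rpow hs hsn] at hvN ⊢
  set N := ∫⁻ y, ‖v y‖ₑ ^ ((n : ℝ) / ((n : ℝ) - s)) with hNdef
  have hN : N ≠ ∞ := by
    intro h
    rw [h, ENNReal.top_rpow_of_pos (by positivity)] at hvN
    exact hvN.ne rfl
  have hscale {l : ℝ≥0} (hl : 0 < l) (x : EuclideanSpace ℝ (Fin n)) :
      ∫⁻ y, ‖u y‖ₑ * ‖v (x - y)‖ₑ =
        l * ∫⁻ y, ((‖u y‖₊ / l : ℝ≥0) : ℝ≥0∞) * ‖v (x - y)‖ₑ := by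
    rw [← lintegral_const_mul' _ _ ENNReal.coe_ne_top]
    refine lintegral_congr fun y => ?_
    rw [← mul_assoc, ← ENNReal.coe_mul, mul_div_cancel₀ _ hl.ne', enorm_eq_nnnorm]
  have hzero (hN0 : N = 0) (x : EuclideanSpace ℝ (Fin n)) : realConv u v x = 0 := by
    rw [← enorm_eq_zero, ← nonpos_iff_eq_zero]
    exact (enorm_realConv_le u v x).trans_eq
      (lintegral_mul_sub_eq_zero hu.1.enorm hg (by positivity) hN0 x)
  have hlux : luxemburgNorm (youngTarget n s A) (realConv u v) ≤
      ((2 : ℝ≥0) : ℝ≥0∞) * N ^ (((n : ℝ) - s) / n) * luxemburgNorm A u := by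
    rcases eq_or_ne N 0 with hN0 | hN0
    · rw [luxemburgNorm_zero hB.map_zero (hzero hN0)]
      exact zero_le
    have hN0' : N ^ (((n : ℝ) - s) / n) ≠ 0 := by simp [hN0, hN]
    obtain ⟨K, hKc⟩ : ∃ K : ℝ≥0, ((2 : ℝ≥0) : ℝ≥0∞) * N ^ (((n : ℝ) - s) / n) = K :=
      ⟨_, (ENNReal.coe_toNNReal (ENNReal.mul_ne_top ENNReal.coe_ne_top hvN.ne)).symm⟩
    have hK0 : 0 < K := by
      rw [← ENNReal.coe_pos, ← hKc]
      exact ENNReal.mul_pos (by simp) hN0'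
    rw [hKc]
    conv_rhs => rw [luxemburgNorm]
    simp_rw [ENNReal.mul_iInf_of_ne (ENNReal.coe_ne_zero.2 hK0.ne') ENNReal.coe_ne_top]
    refine le_iInf₂ fun l ⟨hl, hM1⟩ => ?_
    rw [← ENNReal.coe_mul]
    -- If `l` is admissible for `u`, then `K * l` is admissible for `u * v`.
    refine iInf₂_le (K * l) ⟨mul_pos hK0 hl, ?_⟩
    have h := hA.lintegral_extTop_le hs hsn hpos hH (hr l) hg
      (ne_top_of_le_ne_top ENNReal.one_ne_top hM1) hN hN0
    refine le_trans (lintegral_mono fun x => ?_) (h.trans hM1)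
    have hcoe : youngTarget n s A (‖realConv u v x‖₊ / (K * l)) =
      extTop (youngTarget n s A) ((‖realConv u v x‖₊ / (K * l) : ℝ≥0) : ℝ≥0∞) := by simp [extTop]
    rw [hcoe]
    refine hB.extTop_mono ?_
    rw [ENNReal.coe_div (mul_pos hK0 hl).ne', ← enorm_eq_nnnorm]
    refine ENNReal.div_le_of_le_mul ((enorm_realConv_le u v x).trans ?_)
    rw [hscale hl x, ← hNdef, show (2 : ℝ≥0∞) * N ^ (((n : ℝ) - s) / n) = K from hKc,
      ENNReal.coe_mul, ← mul_assoc, mul_comm (l : ℝ≥0∞)]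
    gcongr
    -- The modular of `u / l` is at most `1`, so dropping its power from the denominator only
    -- decreases the quotient.
    have hMs : (∫⁻ y, A (‖u y‖₊ / l)) ^ (s / (n : ℝ)) ≤ 1 :=
      ENNReal.rpow_le_one hM1 (by positivity)
    calc _ = (∫⁻ y, ((‖u y‖₊ / l : ℝ≥0) : ℝ≥0∞) * ‖v (x - y)‖ₑ) / K * K :=
          (ENNReal.div_mul_cancel (ENNReal.coe_ne_zero.2 hK0.ne') ENNReal.coe_ne_top).symm
      _ ≤ _ := by
          gcongr
          exact mul_le_of_le_one_right' hMs
  refine ⟨?_, ⟨aestronglyMeasurable_realConv hu.1 hv.1, hlux.trans_lt ?_⟩, hlux, ?_⟩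
  · obtain ⟨l, hl⟩ := iInf_lt_iff.1 hu.2
    obtain ⟨⟨hl0, hM1⟩, -⟩ := iInf_lt_iff.1 hl
    filter_upwards [hA.ae_lintegral_mul_sub_lt_top hs hsn hpos hH (hr l) hg
      (ne_top_of_le_ne_top ENNReal.one_ne_top hM1) hN] with x hx
    refine ⟨hu.1.convolution_integrand_snd (ContinuousLinearMap.mul ℝ ℝ) hv.1 x, ?_⟩
    rw [hasFiniteIntegral_iff_enorm]
    simp only [ContinuousLinearMap.mul_apply', enorm_mul]
    rw [hscale hl0 x]
    exact ENNReal.mul_lt_top ENNReal.coe_lt_top hx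
  · exact ENNReal.mul_lt_top (ENNReal.mul_lt_top ENNReal.coe_lt_top hvN) hu.2
  -- The degenerate readings of the quotient: an infinite modular makes the right side `∞`, and `N =
  -- 0` makes the convolution vanish.
  · rcases eq_or_ne (orliczModular A u) ∞ with hM | hM
    · rw [hM]; exact le_top
    rcases eq_or_ne N 0 with hN0 | hN0
    · simp [hzero hN0, extTop, hB.map_zero]
    have hr1 : AEMeasurable (fun y => ‖u y‖₊) volume := hu.1.nnnorm.aemeasurable
    refine le_trans (lintegral_mono fun x => hB.extTop_mono ?_)
      (hA.lintegral_extTop_le hs hsn hpos hH hr1 hg hM hN hN0)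
    exact ENNReal.div_le_div_right (enorm_realConv_le u v x) _
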